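/- Let $k$ be a commutative ring, $A$ a $k$-algebra with unit, and $B$ a $k$-algebra (not necessarily with unit) with idempotent local units $(e_i)_{i\in I}$: each $e_i\in B$ is idempotent, and for every finite $F\subset B$ there is $i\in I$ with $e_ib=be_i=b$ for all $b\in F$. Write $i\le j$ if $e_ie_j=e_je_i=e_i$. Let $P$ be a firm $(B,A)$-bimodule (over $k$), i.e. the canonical maps $B\otimes_BP\to P$ and $P\otimes_AA\to P$ are bijective. Put $B_i=e_iBe_i$ and $P_i=e_iP$, a $(B_i,A)$-bimodule, with inclusions $\sigma_i:P_i\to P$ and $\sigma_{ji}:P_i\to P_j$ $(i\le j)$ and projections $\tau_i:P\to P_i$ and $\tau_{ij}:P_j\to P_i$ given by $p\mapsto e_ip$. Assume that every $P_i$ is finitely generated and projective as a right $A$-module. Let $P_i^*=\mathrm{Hom}_A(P_i,A)$, an $(A,B_i)$-bimodule, and let $$P^\dagger=\{\varphi\in \mathrm{Hom}_A(P,A)\mid \exists\, i\in I:\ \varphi(p)=\varphi(e_ip)\ \text{for all } p\in P\},$$ an $(A,B)$-bimodule by $(a\varphi)(p)=a\varphi(p)$, $(\varphi b)(p)=\varphi(bp)$.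 Then: 1. $P^\dagger$, with the maps $P_i^*\to P^\dagger$, $\varphi\mapsto\varphi\circ\tau_i$, is the colimit of the left $A$-modules $P_i^*$ along the maps $P_i^*\to P_j^*$, $\varphi\mapsto\varphi\circ\tau_{ij}$ $(i\le j)$. 2. Each $P_i$ has a finite dual basis, i.e. elements $z_l\in P_i$, $z_l^*\in P_i^*$ ($1\le l\le n$) with $p=\sum_l z_l\,z_l^*(p)$ for all $p\in P_i$. For each $i$ the $A$-bimodule $G_i=P_i^*\otimes_{B_i}P_i$ has a unique $A$-coring structure (the finite comatrix coring) with $$\Delta_i(\varphi\otimes p)=\sum_l(\varphi\otimes z_l)\otimes_A(z_l^*\otimes p),\qquad \varepsilon_i(\varphi\otimes p)=\varphi(p)$$ for all $\varphi\in P_i^*$, $p\in P_i$ and every finite dual basis $(z_l,z_l^*)$ of $P_i$. 3. The $A$-bimodule $\mathcal G=P^\dagger\otimes_BP$ has a unique $A$-coring structure with $$\Delta\bigl((\varphi\circ\tau_i)\otimes_B\sigma_i(p)\bigr)=\sum_l\bigl((\varphi\circ\tau_i)\otimes_B\sigma_i(z_l)\bigr)\otimes_A\bigl((z_l^*\circ\tau_i)\otimes_B\sigma_i(p)\bigr),\qquad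 \varepsilon\bigl((\varphi\circ\tau_i)\otimes_B\sigma_i(p)\bigr)=\varphi(p)$$ for all $i\in I$, $\varphi\in P_i^*$, $p\in P_i$ and every finite dual basis $(z_l,z_l^*)$ of $P_i$. 4. The maps $G_i\to G_j$, $\varphi\otimes p\mapsto(\varphi\circ\tau_{ij})\otimes\sigma_{ji}(p)$ $(i\le j)$, and $g_i:G_i\to\mathcal G$, $\varphi\otimes p\mapsto(\varphi\circ\tau_i)\otimes_B\sigma_i(p)$, are morphisms of $A$-corings, and $(\mathcal G,(g_i))$ is the colimit of the $G_i$ along these maps, both as an $A$-bimodule and as an $A$-coring. -/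

import Mathlib

open scoped TensorProduct
open MulOpposite (op)

universe w w₁ w₂ w₃ w₄

/-! ## Bimodules over (possibly non-unital) algebras over a commutative ring `k` -/

/-- An `(R, S)`-bimodule over `k`: a `k`-module with commuting `k`-linear associative left `R`-action
and right `S`-action. No unit of `R` or `S` is assumed to exist or to act as the identity;
see `Bimodule.IsFirm`. -/
structure Bimodule (k R S : Type*) [CommRing k] [NonUnitalRing R] [Module k R]
    [NonUnitalRing S] [Module k S] where
  carrier : Type w
  [addCommGroup : AddCommGroup carrier]
  [module : Module k carrier]
  /-- `left r m` is `r m`. -/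
  left : R →ₙₐ[k] Module.End k carrier
  /-- `right (op s) m` is `m s`. -/
  right : Sᵐᵒᵖ →ₙₐ[k] Module.End k carrier
  left_right : ∀ r s m, left r (right s m) = right s (left r m)

namespace Bimodule

attribute [instance] Bimodule.addCommGroup Bimodule.module

section Basics

variable {k R S T U : Type*} [CommRing k] [NonUnitalRing R] [Module k R]
  [NonUnitalRing S] [Module k S] [NonUnitalRing T] [Module k T] [NonUnitalRing U] [Module k U]

/-- Bimodule maps. -/
structure Hom (M : Bimodule.{w₁} k R S) (N : Bimodule.{w₂} k R S) where
  toLin : M.carrier →ₗ[k] N.carrier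
  map_left : ∀ r m, toLin (M.left r m) = N.left r (toLin m)
  map_right : ∀ s m, toLin (M.right s m) = N.right s (toLin m)

/-- The identity map. -/
def Hom.id (M : Bimodule.{w} k R S) : Hom M M where
  toLin := LinearMap.id
  map_left _ _ := rfl
  map_right _ _ := rfl

/-- The submodule of `M ⊗[k] N` generated by all `m s ⊗ n - m ⊗ s n`. -/
def balanced (M : Bimodule.{w₁} k R S) (N : Bimodule.{w₂} k S T) :
    Submodule k (M.carrier ⊗[k] N.carrier) :=
  Submodule.span k {x | ∃ (s : S) (m : M.carrier) (n : N.carrier),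
    x = M.right (op s) m ⊗ₜ[k] n - m ⊗ₜ[k] N.left s n}

/-- The endomorphism of the quotient `M ⊗_S N` induced by `f ⊗ g`. -/
def balancedEnd (M : Bimodule.{w₁} k R S) (N : Bimodule.{w₂} k S T)
    (f : Module.End k M.carrier) (g : Module.End k N.carrier)
    (hf : ∀ s m, f (M.right s m) = M.right s (f m))
    (hg : ∀ s n, g (N.left s n) = N.left s (g n)) :
    Module.End k ((M.carrier ⊗[k] N.carrier) ⧸ balanced M N) :=
  (balanced M N).mapQ (balanced M N) (TensorProduct.map f g) <| by
    refine Submodule.span_le.2 ?_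
    rintro _ ⟨s, m, n, rfl⟩
    refine Submodule.subset_span ⟨s, f m, g n, ?_⟩
    simp [hf, hg]

theorem balanced_ext {M : Bimodule.{w₁} k R S} {N : Bimodule.{w₂} k S T} {X : Type*}
    [AddCommGroup X] [Module k X]
    {f g : ((M.carrier ⊗[k] N.carrier) ⧸ balanced M N) →ₗ[k] X}
    (h : ∀ m n, f (Submodule.Quotient.mk (m ⊗ₜ[k] n)) = g (Submodule.Quotient.mk (m ⊗ₜ[k] n))) :
    f = g := by
  refine Submodule.linearMap_qext _ (TensorProduct.ext' ?_)
  intro m n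
  exact h m n

theorem balancedEnd_mk {M : Bimodule.{w₁} k R S} {N : Bimodule.{w₂} k S T}
    (f : Module.End k M.carrier) (g : Module.End k N.carrier) (hf hg) (m n) :
    balancedEnd M N f g hf hg (Submodule.Quotient.mk (m ⊗ₜ[k] n)) =
      Submodule.Quotient.mk (f m ⊗ₜ[k] g n) := rfl

theorem balancedEnd_comm {M : Bimodule.{w₁} k R S} {N : Bimodule.{w₂} k S T}
    (f : Module.End k M.carrier) (g : Module.End k N.carrier) (hf hg hf' hg') (x) :
    balancedEnd M N f LinearMap.id hf hg (balancedEnd M N LinearMap.id g hf' hg' x) =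
      balancedEnd M N LinearMap.id g hf' hg' (balancedEnd M N f LinearMap.id hf hg x) :=
  LinearMap.congr_fun (f := balancedEnd M N f LinearMap.id hf hg ∘ₗ
    balancedEnd M N LinearMap.id g hf' hg') (g := balancedEnd M N LinearMap.id g hf' hg' ∘ₗ
      balancedEnd M N f LinearMap.id hf hg) (balanced_ext fun _ _ => rfl) x

/-- The tensor product `M ⊗_S N`, as an `(R, T)`-bimodule. -/
def tensor (M : Bimodule.{w₁} k R S) (N : Bimodule.{w₂} k S T) : Bimodule k R T where
  carrier := (M.carrier ⊗[k] N.carrier) ⧸ balanced M N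
  left :=
    { toFun := fun r => balancedEnd M N (M.left r) LinearMap.id
        (fun s m => M.left_right r s m) (fun _ _ => rfl)
      map_smul' := fun c r => balanced_ext fun m n => by
        simp only [MonoidHom.id_apply, LinearMap.smul_apply, balancedEnd_mk, map_smul,
          ← TensorProduct.smul_tmul', Submodule.Quotient.mk_smul]
      map_zero' := balanced_ext fun m n => by
        simp only [balancedEnd_mk, map_zero, LinearMap.zero_apply, TensorProduct.zero_tmul,
          Submodule.Quotient.mk_zero]
      map_add' := fun r r' => balanced_ext fun m n => by
        simp only [balancedEnd_mk, map_add, LinearMap.add_apply, TensorProduct.add_tmul,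
          Submodule.Quotient.mk_add]
      map_mul' := fun r r' => balanced_ext fun m n => by
        simp only [balancedEnd_mk, map_mul, Module.End.mul_apply, LinearMap.id_apply] }
  right :=
    { toFun := fun t => balancedEnd M N LinearMap.id (N.right t)
        (fun _ _ => rfl) (fun s n => (N.left_right s t n).symm)
      map_smul' := fun c r => balanced_ext fun m n => by
        simp only [MonoidHom.id_apply, LinearMap.smul_apply, balancedEnd_mk, map_smul,
          TensorProduct.tmul_smul, Submodule.Quotient.mk_smul]
      map_zero' := balanced_ext fun m n => by
        simp only [balancedEnd_mk, map_zero, LinearMap.zero_apply, TensorProduct.tmul_zero,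
          Submodule.Quotient.mk_zero]
      map_add' := fun r r' => balanced_ext fun m n => by
        simp only [balancedEnd_mk, map_add, LinearMap.add_apply, TensorProduct.tmul_add,
          Submodule.Quotient.mk_add]
      map_mul' := fun r r' => balanced_ext fun m n => by
        simp only [balancedEnd_mk, map_mul, Module.End.mul_apply, LinearMap.id_apply] }
  left_right r t x := balancedEnd_comm (M.left r) (N.right t) (fun s m => M.left_right r s m)
    (fun _ _ => rfl) (fun _ _ => rfl) (fun s n => (N.left_right s t n).symm) x

/-- The pure tensor `m ⊗ n` in `M ⊗_S N`, bilinear in `m` and `n`. -/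
def tmul (M : Bimodule.{w₁} k R S) (N : Bimodule.{w₂} k S T) :
    M.carrier →ₗ[k] N.carrier →ₗ[k] (tensor M N).carrier :=
  (TensorProduct.mk k M.carrier N.carrier).compr₂ (balanced M N).mkQ

theorem tmul_balanced (M : Bimodule.{w₁} k R S) (N : Bimodule.{w₂} k S T) (s : S)
    (m : M.carrier) (n : N.carrier) :
    tmul M N (M.right (op s) m) n = tmul M N m (N.left s n) :=
  (Submodule.Quotient.eq _).2 (Submodule.subset_span ⟨s, m, n, rfl⟩)

theorem tensor_ext {M : Bimodule.{w₁} k R S} {N : Bimodule.{w₂} k S T} {X : Type*}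
    [AddCommGroup X] [Module k X] {f g : (tensor M N).carrier →ₗ[k] X}
    (h : ∀ m n, f (tmul M N m n) = g (tmul M N m n)) : f = g :=
  balanced_ext h

/-- The linear map on `M ⊗_S N` given by an `S`-balanced bilinear map. -/
def lift {M : Bimodule.{w₁} k R S} {N : Bimodule.{w₂} k S T} {X : Type*} [AddCommGroup X]
    [Module k X] (f : M.carrier →ₗ[k] N.carrier →ₗ[k] X)
    (hf : ∀ s m n, f (M.right (op s) m) n = f m (N.left s n)) :
    (tensor M N).carrier →ₗ[k] X :=
  (balanced M N).liftQ (TensorProduct.lift f) <| by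
    refine Submodule.span_le.2 ?_
    rintro _ ⟨s, m, n, rfl⟩
    simp [hf]

@[simp] theorem lift_tmul {M : Bimodule.{w₁} k R S} {N : Bimodule.{w₂} k S T} {X : Type*}
    [AddCommGroup X] [Module k X] (f : M.carrier →ₗ[k] N.carrier →ₗ[k] X)
    (hf : ∀ s m n, f (M.right (op s) m) n = f m (N.left s n)) (m n) :
    lift f hf (tmul M N m n) = f m n := rfl

theorem tensor_left (M : Bimodule.{w₁} k R S) (N : Bimodule.{w₂} k S T) (r m n) :
    (tensor M N).left r (tmul M N m n) = tmul M N (M.left r m) n := rfl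

theorem tensor_right (M : Bimodule.{w₁} k R S) (N : Bimodule.{w₂} k S T) (t m n) :
    (tensor M N).right t (tmul M N m n) = tmul M N m (N.right t n) := rfl

/-- `f ⊗ g : M ⊗_S N → M' ⊗_S N'`, that is `m ⊗ n ↦ f m ⊗ g n`. -/
def map {M : Bimodule.{w₁} k R S} {M' : Bimodule.{w₂} k R S} {N : Bimodule.{w₃} k S T}
    {N' : Bimodule.{w₄} k S T} (f : Hom M M') (g : Hom N N') :
    (tensor M N).carrier →ₗ[k] (tensor M' N').carrier :=
  lift ((tmul M' N').compl₁₂ f.toLin g.toLin) fun s m n => by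
    simp [f.map_right, g.map_left, tmul_balanced]

/-- The bimodule map on `M ⊗_S N` given by an `S`-balanced bilinear map compatible with the
outer actions. -/
def liftHom {M : Bimodule.{w₁} k R S} {N : Bimodule.{w₂} k S T} {X : Bimodule.{w₃} k R T}
    (f : M.carrier →ₗ[k] N.carrier →ₗ[k] X.carrier)
    (hf : ∀ s m n, f (M.right (op s) m) n = f m (N.left s n))
    (hl : ∀ r m n, f (M.left r m) n = X.left r (f m n))
    (hr : ∀ t m n, f m (N.right t n) = X.right t (f m n)) : Hom (tensor M N) X where
  toLin := lift f hf
  map_left r x := LinearMap.congr_fun (f := lift f hf ∘ₗ (tensor M N).left r)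
    (g := X.left r ∘ₗ lift f hf) (tensor_ext fun m n => hl r m n) x
  map_right t x := LinearMap.congr_fun (f := lift f hf ∘ₗ (tensor M N).right t)
    (g := X.right t ∘ₗ lift f hf) (tensor_ext fun m n => hr t m n) x

/-- Auxiliary map for `assoc`: `m ⊗ n ↦ (l ↦ m ⊗ (n ⊗ l))`. -/
def assocAux (M : Bimodule.{w₁} k R S) (N : Bimodule.{w₂} k S T) (L : Bimodule.{w₃} k T U) :
    (tensor M N).carrier →ₗ[k] L.carrier →ₗ[k] (tensor M (tensor N L)).carrier :=
  lift
    (LinearMap.mk₂ k (fun m n => (tmul M (tensor N L) m) ∘ₗ (tmul N L n))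
      (fun _ _ _ => by ext; simp) (fun _ _ _ => by ext; simp)
      (fun _ _ _ => by ext; simp) (fun _ _ _ => by ext; simp))
    (fun s m n => by
      ext l
      exact tmul_balanced M (tensor N L) s m (tmul N L n l))

/-- The canonical map `(M ⊗_S N) ⊗_T L → M ⊗_S (N ⊗_T L)`, `(m ⊗ n) ⊗ l ↦ m ⊗ (n ⊗ l)`. -/
def assoc (M : Bimodule.{w₁} k R S) (N : Bimodule.{w₂} k S T) (L : Bimodule.{w₃} k T U) :
    (tensor (tensor M N) L).carrier →ₗ[k] (tensor M (tensor N L)).carrier :=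
  lift (assocAux M N L) fun t x l => by
    refine LinearMap.congr_fun (f := (assocAux M N L).flip l ∘ₗ (tensor M N).right (op t))
      (g := (assocAux M N L).flip (L.left t l)) (tensor_ext fun m n => ?_) x
    exact congrArg (tmul M (tensor N L) m) (tmul_balanced N L t n l)

@[simp] theorem assoc_tmul (M : Bimodule.{w₁} k R S) (N : Bimodule.{w₂} k S T)
    (L : Bimodule.{w₃} k T U) (m n l) :
    assoc M N L (tmul (tensor M N) L (tmul M N m n) l) =
      tmul M (tensor N L) m (tmul N L n l) := rfl

end Basics

section Firm

variable {k R S : Type*} [CommRing k] [NonUnitalRing R] [Module k R] [IsScalarTower k R R]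
  [SMulCommClass k R R] [NonUnitalRing S] [Module k S] [IsScalarTower k S S]
  [SMulCommClass k S S]

/-- `R` as an `(R, R)`-bimodule. -/
abbrev regular (k R : Type*) [CommRing k] [NonUnitalRing R] [Module k R] [IsScalarTower k R R]
    [SMulCommClass k R R] : Bimodule k R R where
  carrier := R
  left :=
    { toFun := fun r => LinearMap.mulLeft k r
      map_smul' := fun c r => by ext; simp [smul_mul_assoc]
      map_zero' := by ext; simp
      map_add' := fun r r' => by ext; simp [add_mul]
      map_mul' := fun r r' => by ext; simp }
  right :=
    { toFun := fun r => LinearMap.mulRight k r.unop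
      map_smul' := fun c r => by ext; simp [mul_smul_comm]
      map_zero' := by ext; simp
      map_add' := fun r r' => by ext; simp [mul_add]
      map_mul' := fun r r' => by ext; simp }
  left_right r s m := by
    change r * (m * s.unop) = (r * m) * s.unop
    rw [mul_assoc]

/-- The canonical map `R ⊗_R M → M`, `r ⊗ m ↦ r m`. -/
def leftMul (M : Bimodule.{w} k R S) : (tensor (regular k R) M).carrier →ₗ[k] M.carrier :=
  lift (M := regular k R)
    { toFun := fun r : R => M.left r
      map_add' := fun r r' => map_add M.left r r'
      map_smul' := fun c r => map_smul M.left c r }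
    (fun s (r : R) m => LinearMap.congr_fun (map_mul M.left r s) m)

/-- The canonical map `M ⊗_S S → M`, `m ⊗ s ↦ m s`. -/
def rightMul (M : Bimodule.{w} k R S) : (tensor M (regular k S)).carrier →ₗ[k] M.carrier :=
  lift (N := regular k S)
    (LinearMap.flip
      { toFun := fun s : S => M.right (op s)
        map_add' := fun s s' => map_add M.right (op s) (op s')
        map_smul' := fun c s => map_smul M.right c (op s) })
    (fun s m (t : S) => (LinearMap.congr_fun (map_mul M.right (op t) (op s)) m).symm)

/-- A bimodule is firm if `R ⊗_R M → M` and `M ⊗_S S → M` are bijective. -/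
def IsFirm (M : Bimodule.{w} k R S) : Prop :=
  Function.Bijective M.leftMul ∧ Function.Bijective M.rightMul

end Firm

end Bimodule

/-! ## Corings -/

section Coring

open Bimodule

variable {k A : Type*} [CommRing k] [NonUnitalRing A] [Module k A] [IsScalarTower k A A]
  [SMulCommClass k A A]

/-- An `A`-coring structure on an `A`-bimodule `C`, i.e. a coalgebra structure in the monoidal
category of firm `A`-bimodules (for unital `A`, firm means unital). -/
structure Coring (C : Bimodule.{w} k A A) where
  firm : C.IsFirm
  /-- The comultiplication. -/
  comul : Hom C (tensor C C)
  /-- The counit. -/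
  counit : Hom C (regular k A)
  coassoc : ∀ c, assoc C C C (map comul (Hom.id C) (comul.toLin c)) =
    map (Hom.id C) comul (comul.toLin c)
  counit_left : ∀ c, leftMul C (map counit (Hom.id C) (comul.toLin c)) = c
  counit_right : ∀ c, rightMul C (map (Hom.id C) counit (comul.toLin c)) = c

/-- Morphisms of `A`-corings. -/
def IsCoringHom {C : Bimodule.{w₁} k A A} {D : Bimodule.{w₂} k A A} (SC : Coring C)
    (SD : Coring D) (f : Hom C D) : Prop :=
  (∀ c, map f f (SC.comul.toLin c) = SD.comul.toLin (f.toLin c)) ∧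
  (∀ c, SD.counit.toLin (f.toLin c) = SC.counit.toLin c)

end Coring

/-! ## Idempotent local units and the associated direct systems -/

/-- `(e i)` is a family of idempotent local units of `B`. -/
structure IsIdempotentLocalUnits {B I : Type*} [NonUnitalRing B] (e : I → B) : Prop where
  idem : ∀ i, e i * e i = e i
  local_unit : ∀ F : Finset B, ∃ i, ∀ b ∈ F, e i * b = b ∧ b * e i = b

/-- The order on the index set: `i ≤ j` iff `e i * e j = e j * e i = e i`. -/
def IdemLE {B I : Type*} [Mul B] (e : I → B) (i j : I) : Prop :=
  e i * e j = e i ∧ e j * e i = e i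

/-- The subalgebra `B_i = c B c` for `c = e i`. -/
def cornerAlg (k : Type*) {B : Type*} [CommRing k] [NonUnitalRing B] [Module k B]
    [IsScalarTower k B B] [SMulCommClass k B B] (c : B) : NonUnitalSubalgebra k B where
  carrier := {x | ∃ b, x = c * b * c}
  add_mem' := by
    rintro _ _ ⟨b, rfl⟩ ⟨b', rfl⟩
    exact ⟨b + b', by rw [mul_add, add_mul]⟩
  zero_mem' := ⟨0, by simp⟩
  mul_mem' := by
    rintro _ _ ⟨b, rfl⟩ ⟨b', rfl⟩
    exact ⟨b * c * (c * b'), by simp only [mul_assoc]⟩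
  smul_mem' := by
    rintro r _ ⟨b, rfl⟩
    exact ⟨r • b, by simp [smul_mul_assoc, mul_smul_comm]⟩

section System

open Bimodule

/- `P` is a right `A`-module and `act b p` is `b p`. -/
variable {k A B P I : Type*} [CommRing k] [Ring A] [Algebra k A]
  [NonUnitalRing B] [Module k B] [IsScalarTower k B B] [SMulCommClass k B B]
  [AddCommGroup P] [Module k P] [Module Aᵐᵒᵖ P] [IsScalarTower k Aᵐᵒᵖ P]

/-- The right `A`-action of a right `A`-module, in the form used in `Bimodule`. -/
def rightAct (k A M : Type*) [CommRing k] [Ring A] [Algebra k A] [AddCommGroup M] [Module k M]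
    [Module Aᵐᵒᵖ M] [IsScalarTower k Aᵐᵒᵖ M] : Aᵐᵒᵖ →ₙₐ[k] Module.End k M :=
  (Algebra.lsmul k k M : Aᵐᵒᵖ →ₐ[k] Module.End k M)

/-- The `(B, A)`-bimodule `P`. -/
abbrev bimoduleOf (act : B →ₙₐ[k] Module.End Aᵐᵒᵖ P) : Bimodule k B A where
  carrier := P
  left :=
    { toFun := fun b => (act b).restrictScalars k
      map_smul' := fun c b => by ext; simp
      map_zero' := by ext; simp
      map_add' := fun b b' => by ext; simp
      map_mul' := fun b b' => by ext; simp }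
  right := rightAct k A P
  left_right b a p := (act b).map_smul a p

/-- The right `A`-module `P_i = c P` for `c = e i`. -/
def piece (act : B →ₙₐ[k] Module.End Aᵐᵒᵖ P) (c : B) : Submodule Aᵐᵒᵖ P :=
  LinearMap.range (act c)

/-- The projection `τ_i : P → P_i`, `p ↦ c p`. -/
def proj (act : B →ₙₐ[k] Module.End Aᵐᵒᵖ P) (c : B) : P →ₗ[Aᵐᵒᵖ] piece act c :=
  (act c).rangeRestrict

/-- The left action of `b ∈ B_i` on `P_i`. -/
def pieceAct (act : B →ₙₐ[k] Module.End Aᵐᵒᵖ P) (c : B) (b : cornerAlg k c) :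
    Module.End Aᵐᵒᵖ (piece act c) :=
  (act (b : B)).restrict (p := piece act c) (q := piece act c) (by
    obtain ⟨_, b, rfl⟩ := b
    intro p _
    exact ⟨act b (act c p), by simp [map_mul]⟩)

/-- The `(B_i, A)`-bimodule `P_i`. -/
abbrev pieceBimodule (act : B →ₙₐ[k] Module.End Aᵐᵒᵖ P) (c : B) :
    Bimodule k (cornerAlg k c) A where
  carrier := piece act c
  left :=
    { toFun := fun b => (pieceAct act c b).restrictScalars k
      map_smul' := fun r b => by ext; simp [pieceAct]
      map_zero' := by ext; simp [pieceAct]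
      map_add' := fun b b' => by ext; simp [pieceAct]
      map_mul' := fun b b' => by ext; simp [pieceAct] }
  right := rightAct k A (piece act c)
  left_right b a p := (pieceAct act c b).map_smul a p

/-- The dual `P_i^* = Hom_A(P_i, A)`; a left `A`-module by `(a φ)(p) = a φ(p)`. -/
abbrev PieceDual (act : B →ₙₐ[k] Module.End Aᵐᵒᵖ P) (c : B) : Type _ :=
  piece act c →ₗ[Aᵐᵒᵖ] A

/-- The `(A, B_i)`-bimodule `P_i^*`, with `(φ b)(p) = φ(b p)`. -/
abbrev pieceDualBimodule (act : B →ₙₐ[k] Module.End Aᵐᵒᵖ P) (c : B) :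
    Bimodule k A (cornerAlg k c) where
  carrier := PieceDual act c
  left := (Algebra.lsmul k k (PieceDual act c) : A →ₐ[k] Module.End k (PieceDual act c))
  right :=
    { toFun := fun b =>
        { toFun := fun φ => φ ∘ₗ pieceAct act c b.unop
          map_add' := fun φ ψ => rfl
          map_smul' := fun r φ => rfl }
      map_smul' := fun r b => by
        ext φ p
        change φ (pieceAct act c (r • b.unop) p) = r • φ (pieceAct act c b.unop p)
        have : pieceAct act c (r • b.unop) p = r • pieceAct act c b.unop p := by
          ext; simp [pieceAct]
        rw [this]
        exact (φ.restrictScalars k).map_smul r _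
      map_zero' := by
        ext φ p
        change φ (pieceAct act c 0 p) = 0
        have : pieceAct act c 0 p = 0 := by ext; simp [pieceAct]
        rw [this, map_zero]
      map_add' := fun b b' => by
        ext φ p
        change φ (pieceAct act c (b.unop + b'.unop) p) =
          φ (pieceAct act c b.unop p) + φ (pieceAct act c b'.unop p)
        rw [← map_add]
        congr 1
        ext; simp [pieceAct]
      map_mul' := fun b b' => by
        ext φ p
        change φ (pieceAct act c (b'.unop * b.unop) p) =
          φ (pieceAct act c b'.unop (pieceAct act c b.unop p))
        congr 1
        ext; simp [pieceAct] }
  left_right a b φ := rfl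

/-- `P^† = {φ ∈ Hom_A(P, A) | ∃ i, ∀ p, φ(p) = φ(e_i p)}`. -/
def dagger (act : B →ₙₐ[k] Module.End Aᵐᵒᵖ P) {e : I → B} (he : IsIdempotentLocalUnits e) :
    Submodule A (P →ₗ[Aᵐᵒᵖ] A) where
  carrier := {φ | ∃ i, ∀ p, φ p = φ (act (e i) p)}
  add_mem' := by
    classical
    rintro φ ψ ⟨i, hi⟩ ⟨j, hj⟩
    obtain ⟨l, hl⟩ := he.local_unit {e i, e j}
    refine ⟨l, fun p => ?_⟩
    have h1 : φ (act (e l) p) = φ p := by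
      rw [hi, hi p, ← Module.End.mul_apply, ← map_mul, (hl (e i) (by simp)).2]
    have h2 : ψ (act (e l) p) = ψ p := by
      rw [hj, hj p, ← Module.End.mul_apply, ← map_mul, (hl (e j) (by simp)).2]
    rw [LinearMap.add_apply, LinearMap.add_apply, h1, h2]
  zero_mem' := by
    obtain ⟨i, -⟩ := he.local_unit ∅
    exact ⟨i, fun p => rfl⟩
  smul_mem' := by
    rintro a φ ⟨i, hi⟩
    exact ⟨i, fun p => by rw [LinearMap.smul_apply, LinearMap.smul_apply, ← hi]⟩

/-- The `(A, B)`-bimodule `P^†`, with `(φ b)(p) = φ(b p)`. -/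
abbrev daggerBimodule (act : B →ₙₐ[k] Module.End Aᵐᵒᵖ P) {e : I → B}
    (he : IsIdempotentLocalUnits e) : Bimodule k A B where
  carrier := dagger act he
  left := (Algebra.lsmul k k (dagger act he) : A →ₐ[k] Module.End k (dagger act he))
  right :=
    { toFun := fun b =>
        { toFun := fun φ => ⟨φ.1 ∘ₗ act b.unop, by
            obtain ⟨i, hi⟩ := he.local_unit {b.unop}
            refine ⟨i, fun p => ?_⟩
            rw [LinearMap.comp_apply, LinearMap.comp_apply, ← Module.End.mul_apply, ← map_mul,
              (hi b.unop (by simp)).2]⟩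
          map_add' := fun φ ψ => rfl
          map_smul' := fun r φ => rfl }
      map_smul' := fun r b => by
        ext φ p
        change φ.1 (act (r • b.unop) p) = r • φ.1 (act b.unop p)
        rw [map_smul]
        exact (φ.1.restrictScalars k).map_smul r _
      map_zero' := by
        ext φ p
        change φ.1 (act 0 p) = 0
        simp
      map_add' := fun b b' => by
        ext φ p
        change φ.1 (act (b.unop + b'.unop) p) = φ.1 (act b.unop p) + φ.1 (act b'.unop p)
        simp
      map_mul' := fun b b' => by
        ext φ p
        change φ.1 (act (b'.unop * b.unop) p) = φ.1 (act b'.unop (act b.unop p))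
        simp }
  left_right a b φ := rfl

/-- The inclusion `σ_ji : P_i → P_j` for `i ≤ j`. -/
def incl (act : B →ₙₐ[k] Module.End Aᵐᵒᵖ P) {e : I → B} {i j : I} (hij : IdemLE e i j) :
    piece act (e i) →ₗ[Aᵐᵒᵖ] piece act (e j) :=
  Submodule.inclusion (by
    rintro _ ⟨p, rfl⟩
    exact ⟨act (e i) p, by rw [← Module.End.mul_apply, ← map_mul, hij.2]⟩)

/-- The map `τ_ij^* : P_i^* → P_j^*`, `φ ↦ φ ∘ τ_ij`, where `τ_ij : P_j → P_i`, `p ↦ e_i p`. -/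
def dualTrans (act : B →ₙₐ[k] Module.End Aᵐᵒᵖ P) (e : I → B) (i j : I) :
    PieceDual act (e i) →ₗ[A] PieceDual act (e j) where
  toFun φ := φ ∘ₗ proj act (e i) ∘ₗ (piece act (e j)).subtype
  map_add' _ _ := rfl
  map_smul' _ _ := rfl

/-- The map `τ_i^* : P_i^* → P^†`, `φ ↦ φ ∘ τ_i`. -/
def dualMap (act : B →ₙₐ[k] Module.End Aᵐᵒᵖ P) {e : I → B} (he : IsIdempotentLocalUnits e)
    (i : I) : PieceDual act (e i) →ₗ[A] dagger act he where
  toFun φ := ⟨φ ∘ₗ proj act (e i), i, fun p => by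
    have : proj act (e i) (act (e i) p) = proj act (e i) p := by
      ext
      change act (e i) (act (e i) p) = act (e i) p
      rw [← Module.End.mul_apply, ← map_mul, he.idem]
    rw [LinearMap.comp_apply, LinearMap.comp_apply, this]⟩
  map_add' _ _ := rfl
  map_smul' _ _ := rfl

/-- The `A`-bimodule `G_i = P_i^* ⊗_{B_i} P_i`. -/
def finComatrix (act : B →ₙₐ[k] Module.End Aᵐᵒᵖ P) (c : B) : Bimodule k A A :=
  tensor (pieceDualBimodule act c) (pieceBimodule act c)

/-- The `A`-bimodule `G = P^† ⊗_B P`. -/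
def comatrix (act : B →ₙₐ[k] Module.End Aᵐᵒᵖ P) {e : I → B} (he : IsIdempotentLocalUnits e) :
    Bimodule k A A :=
  tensor (daggerBimodule act he) (bimoduleOf act)

/-- The element `φ ⊗ p` of `G_i`. -/
def finTmul (act : B →ₙₐ[k] Module.End Aᵐᵒᵖ P) (c : B) (φ : PieceDual act c)
    (p : piece act c) : (finComatrix act c).carrier :=
  tmul (pieceDualBimodule act c) (pieceBimodule act c) φ p

/-- The element `φ ⊗ p` of `G`. -/
def comTmul (act : B →ₙₐ[k] Module.End Aᵐᵒᵖ P) {e : I → B} (he : IsIdempotentLocalUnits e)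
    (φ : dagger act he) (p : P) : (comatrix act he).carrier :=
  tmul (daggerBimodule act he) (bimoduleOf act) φ p

set_option linter.unusedSectionVars false in
theorem act_corner_comm (act : B →ₙₐ[k] Module.End Aᵐᵒᵖ P) {c : B} (hc : c * c = c) (b : B)
    (p : P) : act (c * b * c) (act c p) = act c (act (c * b * c) p) := by
  rw [← Module.End.mul_apply, ← Module.End.mul_apply, ← map_mul, ← map_mul,
    mul_assoc _ c c, hc, mul_assoc c b c, ← mul_assoc c c, hc]

/-- The transition map `G_i → G_j` for `i ≤ j`: `φ ⊗ p ↦ (φ ∘ τ_ij) ⊗ σ_ji p`. -/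
def transG (act : B →ₙₐ[k] Module.End Aᵐᵒᵖ P) {e : I → B}
    (he : IsIdempotentLocalUnits e) {i j : I} (hij : IdemLE e i j) :
    Hom (finComatrix act (e i)) (finComatrix act (e j)) :=
  liftHom (M := pieceDualBimodule act (e i)) (N := pieceBimodule act (e i))
    ((tmul (pieceDualBimodule act (e j)) (pieceBimodule act (e j))).compl₁₂
      ((dualTrans act e i j).restrictScalars k) ((incl act hij).restrictScalars k))
    (by
      rintro ⟨x, hx⟩ (φ : PieceDual act (e i)) (p : piece act (e i))
      have hx' : x ∈ cornerAlg k (e j) := by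
        obtain ⟨b, rfl⟩ := hx
        refine ⟨e i * b * e i, ?_⟩
        rw [mul_assoc (e j), mul_assoc (e i * b), hij.1, mul_assoc (e i) b, ← mul_assoc (e j),
          hij.2]
      have h1 : (dualTrans act e i j) ((pieceDualBimodule act (e i)).right (op ⟨x, hx⟩) φ) =
          (pieceDualBimodule act (e j)).right (op ⟨x, hx'⟩) (dualTrans act e i j φ) := by
        refine LinearMap.ext fun q =>
          congrArg (DFunLike.coe (F := PieceDual act (e i)) φ) (Subtype.ext ?_)
        change act x (act (e i) q) = act (e i) (act x q)
        obtain ⟨b, rfl⟩ := hx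
        exact act_corner_comm act (he.idem i) b q
      have h2 : incl act hij ((pieceBimodule act (e i)).left ⟨x, hx⟩ p) =
          (pieceBimodule act (e j)).left ⟨x, hx'⟩ (incl act hij p) := rfl
      exact (congrArg (fun y => tmul (pieceDualBimodule act (e j)) (pieceBimodule act (e j)) y
        (incl act hij p)) h1).trans ((tmul_balanced _ _ _ _ _).trans (congrArg _ h2.symm)))
    (fun _ _ _ => rfl) (fun _ _ _ => rfl)

/-- The canonical map `g_i : G_i → G`, `φ ⊗ p ↦ (φ ∘ τ_i) ⊗ p`. -/
def toG (act : B →ₙₐ[k] Module.End Aᵐᵒᵖ P) {e : I → B} (he : IsIdempotentLocalUnits e)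
    (i : I) : Hom (finComatrix act (e i)) (comatrix act he) :=
  liftHom (M := pieceDualBimodule act (e i)) (N := pieceBimodule act (e i))
    ((tmul (daggerBimodule act he) (bimoduleOf act)).compl₁₂
      ((dualMap act he i).restrictScalars k)
      ((piece act (e i)).subtype.restrictScalars k))
    (by
      rintro ⟨x, hx⟩ (φ : PieceDual act (e i)) (p : piece act (e i))
      have h1 : (dualMap act he i) ((pieceDualBimodule act (e i)).right (op ⟨x, hx⟩) φ) =
          (daggerBimodule act he).right (op x) (dualMap act he i φ) := by
        refine Subtype.ext (LinearMap.ext fun q =>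
          congrArg (DFunLike.coe (F := PieceDual act (e i)) φ) (Subtype.ext ?_))
        change act x (act (e i) q) = act (e i) (act x q)
        obtain ⟨b, rfl⟩ := hx
        exact act_corner_comm act (he.idem i) b q
      exact (congrArg (fun y => tmul (daggerBimodule act he) (bimoduleOf act) y (p : P)) h1).trans
        (tmul_balanced (daggerBimodule act he) (bimoduleOf act) x _ (p : P)))
    (fun _ _ _ => rfl) (fun _ _ _ => rfl)

/-- `(z, z')` is a finite dual basis of the right `A`-module `M`: `p = ∑ z_l z'_l(p)` for all `p`. -/
def IsDualBasis {M : Type*} [AddCommGroup M] [Module Aᵐᵒᵖ M] {n : ℕ} (z : Fin n → M)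
    (z' : Fin n → (M →ₗ[Aᵐᵒᵖ] A)) : Prop :=
  ∀ p, p = ∑ l, op (z' l p) • z l

/-- `C` is the finite comatrix coring structure on `G_i = P_i^* ⊗_{B_i} P_i`:
`Δ(φ ⊗ p) = ∑ (φ ⊗ z_l) ⊗ (z'_l ⊗ p)` for each finite dual basis of `P_i`, and
`ε(φ ⊗ p) = φ(p)`. -/
structure IsFinComatrixCoring (act : B →ₙₐ[k] Module.End Aᵐᵒᵖ P) (c : B)
    (C : Coring (finComatrix act c)) : Prop where
  comul_eq : ∀ (φ : PieceDual act c) (p : piece act c) (n : ℕ) (z : Fin n → piece act c)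
    (z' : Fin n → PieceDual act c), IsDualBasis z z' →
      C.comul.toLin (finTmul act c φ p) = ∑ l, tmul (finComatrix act c) (finComatrix act c)
        (finTmul act c φ (z l)) (finTmul act c (z' l) p)
  counit_eq : ∀ (φ : PieceDual act c) (p : piece act c),
    C.counit.toLin (finTmul act c φ p) = φ p

/-- `C` is the comatrix coring structure on `G = P^† ⊗_B P`: for all `i`, `φ ∈ P_i^*`, `p ∈ P_i`,
`Δ((φ ∘ τ_i) ⊗ p) = ∑ ((φ ∘ τ_i) ⊗ z_l) ⊗ ((z'_l ∘ τ_i) ⊗ p)` for each finite dual basis of `P_i`,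
and `ε((φ ∘ τ_i) ⊗ p) = φ(p)`. -/
structure IsComatrixCoring (act : B →ₙₐ[k] Module.End Aᵐᵒᵖ P) {e : I → B}
    (he : IsIdempotentLocalUnits e) (C : Coring (comatrix act he)) : Prop where
  comul_eq : ∀ (i : I) (φ : PieceDual act (e i)) (p : piece act (e i)) (n : ℕ)
    (z : Fin n → piece act (e i)) (z' : Fin n → PieceDual act (e i)), IsDualBasis z z' →
      C.comul.toLin (comTmul act he (dualMap act he i φ) p) =
        ∑ l, tmul (comatrix act he) (comatrix act he)
          (comTmul act he (dualMap act he i φ) (z l)) (comTmul act he (dualMap act he i (z' l)) p)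
  counit_eq : ∀ (i : I) (φ : PieceDual act (e i)) (p : piece act (e i)),
    C.counit.toLin (comTmul act he (dualMap act he i φ) p) = φ p

end System

/-!
The coring structures come from one construction. Let `Q` be an `(A, R)`-bimodule, `N` an
`(R, A)`-bimodule and `ε : Q ⊗_R N → A` a bimodule map. A *local dual basis* consists of `c ∈ R` and
finite families `z_l` in `N` (fixed by `c`), `z'_l` in `Q` (fixed by `c`) such that
`c p = ∑ z_l ε(z'_l ⊗ p)` and `φ c = ∑ ε(φ ⊗ z_l) z'_l` for all `p` and `φ`. Write
`u = ∑ z_l ⊗ z'_l ∈ N ⊗_A Q`. For local dual bases with elements `c`, `d` and tensors `u`, `v`,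
expanding `b w_m` and `z'_l b` yields
`c b v = ∑ z_l ε(z'_l ⊗ b w_m) ⊗ w'_m = ∑ z_l ⊗ ε(z'_l b ⊗ w_m) w'_m = u b d` for every `b ∈ R`.
This single identity (`LocalDualBasis.comulAt_right_right`) shows that
`Δ(φ ⊗ p) = ∑ (φ ⊗ z_l) ⊗ (z'_l ⊗ p)` does not depend on the local dual basis as long as `φ c = φ`,
and that it is `R`-balanced. If any two elements of `Q`, and any element of `N`, are fixed by the
element of some local dual basis, and if `1 ∈ A` acts as the identity, `Δ` and `ε` form a coring
(`exists_coring_of_localDualBasis`).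

A finite dual basis of `P_i` is a local dual basis for the pair `(P^†, P)` with element `e_i`, and
also for the pair `(P_j^*, P_j)` whenever `i ≤ j`. The first fact, with firmness of `P`, gives the
comatrix coring on `P^† ⊗_B P`. The second gives the finite comatrix corings (`i = j`), and it shows
that the transition maps commute with the comultiplications: in the coring of `P_j`, the
comultiplication at `(φ ∘ τ_ij) ⊗ p` may be computed with a dual basis of `P_i`.

For the colimits, every `ψ ∈ P^†` equals `(ψ|P_i) ∘ τ_i` for some `i` and the index set is directed,
so a compatible family of maps is glued by evaluating it at any such `i`
(`exists_linearMap_eq_of_agree`). A bimodule map out of `P^† ⊗_B P` that restricts to coring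
morphisms on all `P_i^* ⊗_{B_i} P_i` is a coring morphism, because the images of these generate.
-/

/-! ### Gluing linear maps -/

/-- Linear maps `F i` that agree on the overlaps of submodules `S i` glue to a linear map, if any
two vectors lie in a common `S i`. -/
theorem exists_linearMap_eq_of_agree {R V X ι : Type*} [Ring R] [AddCommGroup V] [Module R V]
    [AddCommGroup X] [Module R X] (S : ι → Submodule R V) (F : ι → V →ₗ[R] X)
    (hS : ∀ v w, ∃ i, v ∈ S i ∧ w ∈ S i)
    (hF : ∀ i j v, v ∈ S i → v ∈ S j → F i v = F j v) :
    ∃ f : V →ₗ[R] X, ∀ i v, v ∈ S i → f v = F i v := by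
  choose t ht using fun v => (hS v v).imp fun _ h => h.1
  have key : ∀ i v, v ∈ S i → F (t v) v = F i v := fun i v hv => hF _ _ _ (ht v) hv
  refine ⟨{ toFun := fun v => F (t v) v, map_add' := fun v w => ?_, map_smul' := fun r v => ?_ },
    key⟩
  · obtain ⟨i, hv, hw⟩ := hS v w
    rw [key i v hv, key i w hw, key i _ (add_mem hv hw), map_add]
  · rw [key (t v) _ ((S (t v)).smul_mem r (ht v)), map_smul, RingHom.id_apply]

/-! ### Bimodules and corings -/

namespace Bimodule

section Generalities

variable {k R S T : Type*} [CommRing k] [NonUnitalRing R] [Module k R]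
  [NonUnitalRing S] [Module k S] [NonUnitalRing T] [Module k T]

theorem Hom.ext {M : Bimodule.{w₁} k R S} {N : Bimodule.{w₂} k R S} {f g : Hom M N}
    (h : f.toLin = g.toLin) : f = g := by
  cases f; cases g; cases h; rfl

@[simp] theorem map_tmul {M : Bimodule.{w₁} k R S} {M' : Bimodule.{w₂} k R S}
    {N : Bimodule.{w₃} k S T} {N' : Bimodule.{w₄} k S T} (f : Hom M M') (g : Hom N N') (m n) :
    map f g (tmul M N m n) = tmul M' N' (f.toLin m) (g.toLin n) := rfl

theorem map_map {M : Bimodule.{w₁} k R R} {M' : Bimodule.{w₂} k R R} {M'' : Bimodule.{w₃} k R R}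
    {f : Hom M M'} {g : Hom M' M''} {h : Hom M M''} (H : ∀ x, g.toLin (f.toLin x) = h.toLin x)
    (x : (tensor M M).carrier) : map g g (map f f x) = map h h x :=
  LinearMap.congr_fun (f := map g g ∘ₗ map f f) (tensor_ext fun m n => by
    simp only [LinearMap.comp_apply, map_tmul, H]) x

end Generalities

section Unital

variable {k A : Type*} [CommRing k] [Ring A] [Algebra k A]

/-- A bimodule over a unital algebra is firm as soon as the unit acts as the identity on both sides;
the inverses are `m ↦ 1 ⊗ m` and `m ↦ m ⊗ 1`. -/
theorem isFirm_of_unital (M : Bimodule.{w} k A A) (hl : ∀ m, M.left 1 m = m)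
    (hr : ∀ m, M.right (op 1) m = m) : M.IsFirm := by
  constructor
  · have h : ∀ x, tmul (regular k A) M (1 : A) (leftMul M x) = x :=
      LinearMap.congr_fun (f := tmul (regular k A) M (1 : A) ∘ₗ leftMul M) (g := LinearMap.id)
        (tensor_ext fun (r : A) m => (tmul_balanced (regular k A) M r (1 : A) m).symm.trans
          (congrArg (fun y : A => tmul (regular k A) M y m) (one_mul r)))
    exact ⟨Function.LeftInverse.injective h, fun m => ⟨tmul (regular k A) M (1 : A) m, hl m⟩⟩
  · have h : ∀ x, tmul M (regular k A) (rightMul M x) (1 : A) = x :=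
      LinearMap.congr_fun (f := (tmul M (regular k A)).flip (1 : A) ∘ₗ rightMul M)
        (g := LinearMap.id)
        (tensor_ext fun m (r : A) => (tmul_balanced M (regular k A) r m (1 : A)).trans
          (congrArg (fun y : A => tmul M (regular k A) m y) (mul_one r)))
    exact ⟨Function.LeftInverse.injective (g := fun m => tmul M (regular k A) m (1 : A)) h,
      fun m => ⟨tmul M (regular k A) m (1 : A), hr m⟩⟩

end Unital

/-! ### Corings from local dual bases -/

section Comatrix

variable {k A R : Type*} [CommRing k] [Ring A] [Algebra k A] [NonUnitalRing R] [Module k R]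
  {Q : Bimodule.{w₁} k A R} {N : Bimodule.{w₂} k R A}

/-- A finite dual basis, relative to the pairing `ε`, of the parts of `N` and `Q` on which `unit`
acts as a unit. For functionals on `N` paired by evaluation, `coexpand` follows from `expand`; for
a general pairing it is a separate condition. -/
structure LocalDualBasis (ε : Hom (tensor Q N) (regular k A)) where
  /-- The element of `R` acting as a local unit. -/
  unit : R
  /-- The number of basis elements. -/
  n : ℕ
  /-- The vectors `z_l`. -/
  vec : Fin n → N.carrier
  /-- The covectors `z'_l`. -/
  covec : Fin n → Q.carrier
  unit_vec : ∀ l, N.left unit (vec l) = vec l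
  covec_unit : ∀ l, Q.right (op unit) (covec l) = covec l
  expand : ∀ p, N.left unit p = ∑ l, N.right (op (ε.toLin (tmul Q N (covec l) p) : A)) (vec l)
  coexpand : ∀ φ, Q.right (op unit) φ = ∑ l, Q.left (ε.toLin (tmul Q N φ (vec l)) : A) (covec l)

namespace LocalDualBasis

variable {ε : Hom (tensor Q N) (regular k A)}

/-- The bilinear map `(φ, p) ↦ ∑ (φ ⊗ z_l) ⊗ (z'_l ⊗ p)`, with values in
`(Q ⊗_R N) ⊗_A (Q ⊗_R N)`. -/
def comulAt (D : LocalDualBasis ε) :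
    Q.carrier →ₗ[k] N.carrier →ₗ[k] (tensor (tensor Q N) (tensor Q N)).carrier :=
  ∑ l, (tmul (tensor Q N) (tensor Q N)).compl₁₂ ((tmul Q N).flip (D.vec l)) (tmul Q N (D.covec l))

theorem comulAt_apply (D : LocalDualBasis ε) (φ p) :
    D.comulAt φ p = ∑ l, tmul (tensor Q N) (tensor Q N) (tmul Q N φ (D.vec l))
      (tmul Q N (D.covec l) p) := by
  simp [comulAt, LinearMap.sum_apply]

/-- The identity `c b v = u b d` in `N ⊗_A Q`, where `(c, u)` comes from `D` and `(d, v)` from `E`,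
inserted between `φ` and `p`. -/
theorem comulAt_right_right (D E : LocalDualBasis ε) (b : R) (φ p) :
    E.comulAt (Q.right (op b) (Q.right (op D.unit) φ)) p =
      D.comulAt φ (N.left b (N.left E.unit p)) := by
  have hR : ∀ m, tmul (tensor Q N) (tensor Q N)
      (tmul Q N (Q.right (op b) (Q.right (op D.unit) φ)) (E.vec m)) (tmul Q N (E.covec m) p) =
      ∑ l, tmul (tensor Q N) (tensor Q N) (tmul Q N φ (D.vec l)) (tmul Q N
        (Q.left (ε.toLin (tmul Q N (Q.right (op b) (D.covec l)) (E.vec m)) : A)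
        (E.covec m)) p) := by
    intro m
    rw [tmul_balanced, tmul_balanced, D.expand, map_sum, map_sum, LinearMap.sum_apply]
    refine Finset.sum_congr rfl fun l _ => ?_
    rw [← tensor_right, tmul_balanced, tensor_left, ← tmul_balanced]
  have hL : ∀ l, tmul (tensor Q N) (tensor Q N) (tmul Q N φ (D.vec l))
      (tmul Q N (D.covec l) (N.left b (N.left E.unit p))) =
      ∑ m, tmul (tensor Q N) (tensor Q N) (tmul Q N φ (D.vec l)) (tmul Q N
        (Q.left (ε.toLin (tmul Q N (Q.right (op b) (D.covec l)) (E.vec m)) : A)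
        (E.covec m)) p) := by
    intro l
    rw [← tmul_balanced, ← tmul_balanced, E.coexpand, map_sum, LinearMap.sum_apply, map_sum]
  rw [comulAt_apply, comulAt_apply, Finset.sum_congr rfl fun m _ => hR m,
    Finset.sum_congr rfl fun l _ => hL l, Finset.sum_comm]

theorem comulAt_left_unit (D : LocalDualBasis ε) (φ p) :
    D.comulAt φ (N.left D.unit p) = D.comulAt φ p := by
  simp only [comulAt_apply, ← tmul_balanced, D.covec_unit]

/-- If the local units of `D` and `E` fix `φ` and `p` respectively, both compute the same
value at `(φ, p)`. Hence the value is the same for all local dual bases whose unit fixes `φ`. -/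
theorem comulAt_eq (D E : LocalDualBasis ε) {φ p} (hφ : Q.right (op D.unit) φ = φ)
    (hp : N.left E.unit p = p) : D.comulAt φ p = E.comulAt φ p := by
  have := comulAt_right_right D E D.unit φ p
  rwa [hφ, hφ, hp, comulAt_left_unit, eq_comm] at this

end LocalDualBasis

/-- The coring `Q ⊗_R N` with counit `ε`, whose comultiplication at `φ ⊗ p` may be computed with any
local dual basis whose unit fixes `φ`. -/
theorem exists_coring_of_localDualBasis (ε : Hom (tensor Q N) (regular k A))
    (hl : ∀ φ, Q.left (1 : A) φ = φ) (hr : ∀ p, N.right (op (1 : A)) p = p)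
    (hQ : ∀ φ ψ, ∃ D : LocalDualBasis ε, Q.right (op D.unit) φ = φ ∧ Q.right (op D.unit) ψ = ψ)
    (hN : ∀ p, ∃ D : LocalDualBasis ε, N.left D.unit p = p) :
    ∃ C : Coring (tensor Q N), C.counit = ε ∧ ∀ (D : LocalDualBasis ε) (φ p),
      Q.right (op D.unit) φ = φ → C.comul.toLin (tmul Q N φ p) = ∑ l, tmul (tensor Q N)
        (tensor Q N) (tmul Q N φ (D.vec l)) (tmul Q N (D.covec l) p) := by
  obtain ⟨F, hF⟩ := exists_linearMap_eq_of_agree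
    (fun D : LocalDualBasis ε => LinearMap.eqLocus (Q.right (op D.unit)) LinearMap.id)
    (fun D => D.comulAt)
    hQ
    (fun D E φ hD hE => by
      ext p
      obtain ⟨G, hG⟩ := hN p
      rw [D.comulAt_eq G hD hG, E.comulAt_eq G hE hG])
  replace hF : ∀ (D : LocalDualBasis ε) φ, Q.right (op D.unit) φ = φ → F φ = D.comulAt φ :=
    hF
  have hbal : ∀ b φ p, F (Q.right (op b) φ) p = F φ (N.left b p) := by
    intro b φ p
    obtain ⟨D, hD, -⟩ := hQ φ φ
    obtain ⟨E, hE, -⟩ := hQ (Q.right (op b) φ) φ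
    obtain ⟨G, hG⟩ := hN p
    have := D.comulAt_right_right G b φ p
    rw [hF D φ hD, hF E _ hE, E.comulAt_eq G hE hG]
    rwa [hD, hG] at this
  have hleft : ∀ a φ p, F (Q.left a φ) p =
      (tensor (tensor Q N) (tensor Q N)).left a (F φ p) := by
    intro a φ p
    obtain ⟨D, hD, -⟩ := hQ φ φ
    rw [hF D φ hD, hF D _ (by rw [← Q.left_right, hD]), D.comulAt_apply, D.comulAt_apply, map_sum]
    rfl
  have hright : ∀ a φ p, F φ (N.right a p) =
      (tensor (tensor Q N) (tensor Q N)).right a (F φ p) := by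
    intro a φ p
    obtain ⟨D, hD, -⟩ := hQ φ φ
    rw [hF D φ hD, D.comulAt_apply, D.comulAt_apply, map_sum]
    rfl
  have hΔ : ∀ (D : LocalDualBasis ε) (φ p), Q.right (op D.unit) φ = φ →
      lift F hbal (tmul Q N φ p) = ∑ l, tmul (tensor Q N) (tensor Q N)
        (tmul Q N φ (D.vec l)) (tmul Q N (D.covec l) p) := by
    intro D φ p hD
    rw [lift_tmul, hF D φ hD, D.comulAt_apply]
  let Δ : Hom (tensor Q N) (tensor (tensor Q N) (tensor Q N)) := liftHom F hbal hleft hright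
  replace hΔ : ∀ (D : LocalDualBasis ε) (φ p), Q.right (op D.unit) φ = φ →
      Δ.toLin (tmul Q N φ p) = ∑ l, tmul (tensor Q N) (tensor Q N)
        (tmul Q N φ (D.vec l)) (tmul Q N (D.covec l) p) := hΔ
  refine ⟨⟨isFirm_of_unital _ ?_ ?_, Δ, ε, ?_, ?_, ?_⟩, rfl, hΔ⟩
  · exact LinearMap.congr_fun (g := LinearMap.id) (tensor_ext fun φ p =>
      congrArg (fun y => tmul Q N y p) (hl φ))
  · exact LinearMap.congr_fun (g := LinearMap.id) (tensor_ext fun φ p =>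
      congrArg (tmul Q N φ) (hr p))
  · refine LinearMap.congr_fun (f := assoc _ _ _ ∘ₗ map Δ (Hom.id _) ∘ₗ Δ.toLin)
      (g := map (Hom.id _) Δ ∘ₗ Δ.toLin) (tensor_ext fun φ p => ?_)
    -- One local dual basis whose unit fixes `φ` computes all comultiplications below, since that
    -- unit also fixes the covectors.
    obtain ⟨D, hD, -⟩ := hQ φ φ
    have h1 : ∀ l, map Δ (Hom.id _) (tmul (tensor Q N) (tensor Q N) (tmul Q N φ (D.vec l))
        (tmul Q N (D.covec l) p)) = ∑ m, tmul _ (tensor Q N) (tmul (tensor Q N) (tensor Q N)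
          (tmul Q N φ (D.vec m)) (tmul Q N (D.covec m) (D.vec l))) (tmul Q N (D.covec l) p) := by
      intro l
      rw [map_tmul, hΔ D _ _ hD, map_sum, LinearMap.sum_apply]
      rfl
    have h2 : ∀ l, map (Hom.id _) Δ (tmul (tensor Q N) (tensor Q N) (tmul Q N φ (D.vec l))
        (tmul Q N (D.covec l) p)) = ∑ m, tmul (tensor Q N) _ (tmul Q N φ (D.vec l))
          (tmul (tensor Q N) (tensor Q N)
          (tmul Q N (D.covec l) (D.vec m)) (tmul Q N (D.covec m) p)) := by
      intro l
      rw [map_tmul, hΔ D _ _ (D.covec_unit l), map_sum]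
      rfl
    simp only [LinearMap.comp_apply, hΔ D φ p hD, map_sum, h1, h2, assoc_tmul]
    exact Finset.sum_comm
  · refine LinearMap.congr_fun (f := leftMul _ ∘ₗ map ε (Hom.id _) ∘ₗ Δ.toLin)
      (g := LinearMap.id) (tensor_ext fun φ p => ?_)
    obtain ⟨D, hD, -⟩ := hQ φ φ
    simp only [LinearMap.comp_apply, hΔ D φ p hD, map_sum, LinearMap.id_apply]
    conv_rhs => rw [← hD, D.coexpand, map_sum, LinearMap.sum_apply]
    rfl
  · refine LinearMap.congr_fun (f := rightMul _ ∘ₗ map (Hom.id _) ε ∘ₗ Δ.toLin)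
      (g := LinearMap.id) (tensor_ext fun φ p => ?_)
    obtain ⟨D, hD, -⟩ := hQ φ φ
    simp only [LinearMap.comp_apply, hΔ D φ p hD, map_sum, LinearMap.id_apply]
    conv_rhs => rw [← hD, tmul_balanced, D.expand, map_sum]
    rfl

end Comatrix

end Bimodule

theorem Coring.ext_of_hom {k A : Type*} [CommRing k] [NonUnitalRing A] [Module k A]
    [IsScalarTower k A A] [SMulCommClass k A A] {M : Bimodule.{w} k A A} {C D : Coring M}
    (h₁ : C.comul.toLin = D.comul.toLin) (h₂ : C.counit.toLin = D.counit.toLin) : C = D := by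
  have h₁ := Bimodule.Hom.ext h₁
  have h₂ := Bimodule.Hom.ext h₂
  cases C; cases D
  cases h₁; cases h₂
  rfl

/-! ### Dual bases and local units -/

section System

set_option linter.unusedSectionVars false

open Bimodule

variable {k A B P I : Type*} [CommRing k] [Ring A] [Algebra k A]
  [NonUnitalRing B] [Module k B] [IsScalarTower k B B] [SMulCommClass k B B]
  [AddCommGroup P] [Module k P] [Module Aᵐᵒᵖ P] [IsScalarTower k Aᵐᵒᵖ P]

theorem exists_isDualBasis {M : Type*} [AddCommGroup M] [Module Aᵐᵒᵖ M] [Module.Finite Aᵐᵒᵖ M]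
    [Module.Projective Aᵐᵒᵖ M] :
    ∃ (n : ℕ) (z : Fin n → M) (z' : Fin n → (M →ₗ[Aᵐᵒᵖ] A)), IsDualBasis z z' := by
  obtain ⟨n, f, hf⟩ := Module.Finite.exists_fin' Aᵐᵒᵖ M
  obtain ⟨g, hg⟩ := Module.projective_lifting_property f LinearMap.id hf
  refine ⟨n, fun l => f (Pi.single l 1), fun l =>
    { toFun := fun p => (g p l).unop, map_add' := fun p q => ?_, map_smul' := fun a p => ?_ },
    fun p => ?_⟩
  · simp
  · simp
  · conv_lhs => rw [← LinearMap.id_apply (R := Aᵐᵒᵖ) p, ← hg, LinearMap.comp_apply,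
      ← LinearMap.sum_single_apply (fun _ => Aᵐᵒᵖ) (g p), map_sum]
    refine Finset.sum_congr rfl fun l _ => ?_
    rw [← map_smul]
    congr 1
    ext m
    simp [Pi.single_apply]

theorem IsDualBasis.apply_eq_sum {M : Type*} [AddCommGroup M] [Module Aᵐᵒᵖ M] {n : ℕ}
    {z : Fin n → M} {z' : Fin n → (M →ₗ[Aᵐᵒᵖ] A)} (h : IsDualBasis z z') (φ : M →ₗ[Aᵐᵒᵖ] A)
    (p : M) : φ p = ∑ l, φ (z l) * z' l p := by
  conv_lhs => rw [h p, map_sum]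
  simp

theorem IsIdempotentLocalUnits.exists_idemLE {e : I → B} (he : IsIdempotentLocalUnits e) (i j : I)
    (b : B) : ∃ l, IdemLE e i l ∧ IdemLE e j l ∧ e l * b = b ∧ b * e l = b := by
  classical
  obtain ⟨l, hl⟩ := he.local_unit {e i, e j, b}
  exact ⟨l, (hl (e i) (by simp)).symm, (hl (e j) (by simp)).symm, hl b (by simp)⟩

theorem IsIdempotentLocalUnits.idemLE_refl {e : I → B} (he : IsIdempotentLocalUnits e) (i : I) :
    IdemLE e i i :=
  ⟨he.idem i, he.idem i⟩

variable (act : B →ₙₐ[k] Module.End Aᵐᵒᵖ P) {e : I → B}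

theorem act_act (b b' : B) (p : P) : act b (act b' p) = act (b * b') p := by
  rw [← Module.End.mul_apply, ← map_mul]

variable {act} in
theorem act_of_mem_piece {c : B} (hc : c * c = c) (p : piece act c) : act c p = p := by
  obtain ⟨_, p, rfl⟩ := p
  exact (act_act act c c p).trans (by rw [hc])

theorem proj_coe (he : IsIdempotentLocalUnits e) {i : I} (p : piece act (e i)) :
    proj act (e i) p = p :=
  Subtype.ext (act_of_mem_piece (he.idem i) p)

theorem dualTrans_self (he : IsIdempotentLocalUnits e) (i : I) (φ : PieceDual act (e i)) :
    dualTrans act e i i φ = φ :=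
  LinearMap.ext fun p => congrArg φ (proj_coe act he p)

/-- Firmness of `P` is used only here: every element of `P` is a finite sum of elements `b p`. -/
theorem exists_act_eq_self (he : IsIdempotentLocalUnits e) (hfirm : (bimoduleOf act).IsFirm)
    (p : P) : ∃ i, act (e i) p = p := by
  have key : ∀ f : B ⊗[k] P →ₗ[k] P, (∀ b p, f (b ⊗ₜ p) = act b p) →
      ∀ t, ∃ i, act (e i) (f t) = f t := by
    intro f hf t
    induction t using TensorProduct.induction_on with
    | zero =>
      obtain ⟨i, -⟩ := he.local_unit ∅
      exact ⟨i, by simp⟩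
    | tmul b p =>
      obtain ⟨i, hi⟩ := he.local_unit {b}
      exact ⟨i, by rw [hf, act_act, (hi b (by simp)).1]⟩
    | add x y hx hy =>
      obtain ⟨i, hi⟩ := hx
      obtain ⟨j, hj⟩ := hy
      obtain ⟨l, hil, hjl, -⟩ := he.exists_idemLE i j (e i)
      exact ⟨l, by rw [map_add, map_add, ← hi, ← hj, act_act, act_act, hil.2, hjl.2]⟩
  obtain ⟨x, rfl⟩ := hfirm.1.2 p
  obtain ⟨x, rfl⟩ := Submodule.Quotient.mk_surjective _ x
  exact key (leftMul (bimoduleOf act) ∘ₗ (balanced (regular k B) (bimoduleOf act)).mkQ)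
    (fun _ _ => rfl) x

/-! ### `P^†` as a colimit -/

/-- The restriction `P^† → P_i^*`, `ψ ↦ ψ|P_i`. It is a left inverse of `dualMap`, and
`dualMap ∘ daggerRes` is `ψ ↦ ψ ∘ e_i`. -/
def daggerRes (he : IsIdempotentLocalUnits e) (i : I) :
    dagger act he →ₗ[A] PieceDual act (e i) where
  toFun ψ := ψ.1 ∘ₗ (piece act (e i)).subtype
  map_add' _ _ := rfl
  map_smul' _ _ := rfl

theorem daggerRes_dualMap (he : IsIdempotentLocalUnits e) (i : I) (φ : PieceDual act (e i)) :
    daggerRes act he i (dualMap act he i φ) = φ :=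
  dualTrans_self act he i φ

theorem exists_dualMap_daggerRes (he : IsIdempotentLocalUnits e) (ψ : dagger act he) :
    ∃ i, dualMap act he i (daggerRes act he i ψ) = ψ := by
  obtain ⟨ψ, i, hi⟩ := ψ
  exact ⟨i, Subtype.ext (LinearMap.ext fun p => (hi p).symm)⟩

theorem dualMap_dualTrans (he : IsIdempotentLocalUnits e) {i j : I} (hij : IdemLE e i j)
    (φ : PieceDual act (e i)) :
    dualMap act he j (dualTrans act e i j φ) = dualMap act he i φ :=
  Subtype.ext (LinearMap.ext fun p => congrArg φ (Subtype.ext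
    ((act_act act (e i) (e j) p).trans (by rw [hij.1]; rfl))))

theorem daggerRes_of_le (he : IsIdempotentLocalUnits e) {i : I} (j : I) {ψ : dagger act he}
    (hi : dualMap act he i (daggerRes act he i ψ) = ψ) :
    daggerRes act he j ψ = dualTrans act e i j (daggerRes act he i ψ) := by
  conv_lhs => rw [← hi]
  rfl

theorem dualMap_daggerRes_of_le (he : IsIdempotentLocalUnits e) {i j : I} (hij : IdemLE e i j)
    {ψ : dagger act he} (hi : dualMap act he i (daggerRes act he i ψ) = ψ) :
    dualMap act he j (daggerRes act he j ψ) = ψ := by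
  rw [daggerRes_of_le act he j hi, dualMap_dualTrans act he hij, hi]

theorem exists_dualMap_daggerRes₂ (he : IsIdempotentLocalUnits e) (ψ ψ' : dagger act he) :
    ∃ i, dualMap act he i (daggerRes act he i ψ) = ψ ∧
      dualMap act he i (daggerRes act he i ψ') = ψ' := by
  obtain ⟨i, hi⟩ := exists_dualMap_daggerRes act he ψ
  obtain ⟨j, hj⟩ := exists_dualMap_daggerRes act he ψ'
  obtain ⟨l, hil, hjl, -⟩ := he.exists_idemLE i j (e i)
  exact ⟨l, dualMap_daggerRes_of_le act he hil hi, dualMap_daggerRes_of_le act he hjl hj⟩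

/-- The `A`-submodule of those `ψ ∈ P^†` with `ψ = ψ ∘ e_i`. -/
def daggerAt (he : IsIdempotentLocalUnits e) (i : I) : Submodule A (dagger act he) :=
  LinearMap.eqLocus (dualMap act he i ∘ₗ daggerRes act he i)
    (LinearMap.id : dagger act he →ₗ[A] dagger act he)

theorem dagger_isColimit (he : IsIdempotentLocalUnits e) (M : Type w₁) [AddCommGroup M]
    [Module A M] (m : ∀ i, PieceDual act (e i) →ₗ[A] M)
    (hm : ∀ i j, IdemLE e i j → ∀ φ, m j (dualTrans act e i j φ) = m i φ) :
    ∃! f : dagger act he →ₗ[A] M, ∀ i φ, f (dualMap act he i φ) = m i φ := by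
  let F (i : I) : dagger act he →ₗ[A] M := m i ∘ₗ daggerRes act he i
  obtain ⟨f, hf⟩ := exists_linearMap_eq_of_agree (R := A) (V := dagger act he) (X := M)
    (daggerAt act he) F
    (exists_dualMap_daggerRes₂ act he)
    (fun i j ψ hi hj => by
      obtain ⟨l, hil, hjl, -⟩ := he.exists_idemLE i j (e i)
      change m i (daggerRes act he i ψ) = m j (daggerRes act he j ψ)
      rw [← hm i l hil, ← hm j l hjl, ← daggerRes_of_le act he l hi,
        ← daggerRes_of_le act he l hj])
  replace hf : ∀ i ψ, dualMap act he i (daggerRes act he i ψ) = ψ → f ψ = F i ψ := hf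
  refine ⟨f, fun i φ => ?_, fun g hg => LinearMap.ext fun ψ => ?_⟩
  · rw [hf i _ (congrArg (dualMap act he i) (daggerRes_dualMap act he i φ))]
    exact congrArg (m i) (daggerRes_dualMap act he i φ)
  · obtain ⟨i, hi⟩ := exists_dualMap_daggerRes act he ψ
    rw [hf i ψ hi]
    exact (congrArg g hi).symm.trans (hg i _)

/-! ### The comatrix corings -/

/-- The evaluation `P_i^* ⊗_{B_i} P_i → A`, `φ ⊗ p ↦ φ(p)`. -/
def finComatrixEval (c : B) : Hom (finComatrix act c) (regular k A) :=
  liftHom (M := pieceDualBimodule act c) (N := pieceBimodule act c) (X := regular k A)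
    (LinearMap.mk₂ k (fun (φ : PieceDual act c) (p : piece act c) => φ p) (fun _ _ _ => rfl)
      (fun _ _ _ => rfl) (fun φ => map_add φ) (fun r φ => (φ.restrictScalars k).map_smul r))
    (fun _ _ _ => rfl) (fun _ _ _ => rfl) (fun a φ p => map_smul (φ : PieceDual act c) a p)

/-- The evaluation `P^† ⊗_B P → A`, `φ ⊗ p ↦ φ(p)`. -/
def comatrixEval (he : IsIdempotentLocalUnits e) : Hom (comatrix act he) (regular k A) :=
  liftHom (M := daggerBimodule act he) (N := bimoduleOf act) (X := regular k A)
    (LinearMap.mk₂ k (fun (φ : dagger act he) (p : P) => φ.1 p) (fun _ _ _ => rfl)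
      (fun _ _ _ => rfl) (fun φ => map_add φ.1) (fun r φ => (φ.1.restrictScalars k).map_smul r))
    (fun _ _ _ => rfl) (fun _ _ _ => rfl) (fun a φ p => map_smul (φ : dagger act he).1 a p)

theorem IdemLE.mem_cornerAlg {i j : I} (hij : IdemLE e i j) :
    e i ∈ cornerAlg k (e j) :=
  ⟨e i, by rw [hij.2, hij.1]⟩

variable {act}

/-- A finite dual basis of `P_i` as a local dual basis for `(P^†, P)` with local unit `e_i`. -/
def IsDualBasis.localDualBasis (he : IsIdempotentLocalUnits e) {i : I} {n : ℕ}
    {z : Fin n → piece act (e i)} {z' : Fin n → PieceDual act (e i)} (h : IsDualBasis z z') :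
    LocalDualBasis (Q := daggerBimodule act he) (N := bimoduleOf act) (comatrixEval act he) where
  unit := e i
  n := n
  vec l := (z l : P)
  covec l := dualMap act he i (z' l)
  unit_vec l := act_of_mem_piece (he.idem i) (z l)
  covec_unit l := dualMap_dualTrans act he (he.idemLE_refl i) (z' l)
  expand p := by
    refine (congrArg Subtype.val (h (proj act (e i) p))).trans ?_
    rw [AddSubmonoidClass.coe_finsetSum]
    rfl
  coexpand ψ := by
    refine Subtype.ext (LinearMap.ext fun p => ?_)
    refine (h.apply_eq_sum (daggerRes act he i ψ) (proj act (e i) p)).trans ?_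
    rw [AddSubmonoidClass.coe_finsetSum, LinearMap.sum_apply]
    rfl

/-- A finite dual basis of `P_i` as a local dual basis for `(P_j^*, P_j)` with local unit
`e_i ∈ B_j`, where `i ≤ j`. -/
def IsDualBasis.localDualBasisOfLE (he : IsIdempotentLocalUnits e) {i j : I} (hij : IdemLE e i j)
    {n : ℕ} {z : Fin n → piece act (e i)} {z' : Fin n → PieceDual act (e i)}
    (h : IsDualBasis z z') :
    LocalDualBasis (Q := pieceDualBimodule act (e j)) (N := pieceBimodule act (e j))
      (finComatrixEval act (e j)) where
  unit := ⟨e i, hij.mem_cornerAlg⟩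
  n := n
  vec l := incl act hij (z l)
  covec l := dualTrans act e i j (z' l)
  unit_vec l := Subtype.ext (act_of_mem_piece (he.idem i) (z l))
  covec_unit l := LinearMap.ext fun p => congrArg (z' l) (proj_coe act he (proj act (e i) p))
  expand p := by
    refine Subtype.ext ((congrArg Subtype.val (h (proj act (e i) p))).trans ?_)
    rw [AddSubmonoidClass.coe_finsetSum, AddSubmonoidClass.coe_finsetSum]
    rfl
  coexpand φ := by
    refine LinearMap.ext fun p => ?_
    refine (h.apply_eq_sum (φ ∘ₗ incl act hij) (proj act (e i) p)).trans ?_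
    rw [LinearMap.sum_apply]
    rfl

/-- The finite comatrix coring on `P_j^* ⊗_{B_j} P_j`. On `φ ∘ τ_ij` with `i ≤ j`, its
comultiplication can be computed with dual bases of the smaller module `P_i`. -/
theorem exists_finComatrixCoring (he : IsIdempotentLocalUnits e) (j : I) {n : ℕ}
    {z : Fin n → piece act (e j)} {z' : Fin n → PieceDual act (e j)} (h : IsDualBasis z z') :
    ∃ C : Coring (finComatrix act (e j)), IsFinComatrixCoring act (e j) C ∧
      ∀ (i : I) (_ : IdemLE e i j) (n : ℕ) (z : Fin n → piece act (e i))
        (z' : Fin n → PieceDual act (e i)), IsDualBasis z z' →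
        ∀ (φ : PieceDual act (e i)) (p : piece act (e j)),
        C.comul.toLin (finTmul act (e j) (dualTrans act e i j φ) p) =
          ∑ l, tmul (finComatrix act (e j)) (finComatrix act (e j))
            (finTmul act (e j) (dualTrans act e i j φ) (incl act ‹_› (z l)))
            (finTmul act (e j) (dualTrans act e i j (z' l)) p) := by
  have hu := he.idemLE_refl j
  obtain ⟨C, hε, hΔ⟩ := exists_coring_of_localDualBasis (Q := pieceDualBimodule act (e j))
    (N := pieceBimodule act (e j)) (finComatrixEval act (e j)) (fun φ => one_smul A φ)
    (fun p => one_smul Aᵐᵒᵖ p)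
    (fun φ ψ => ⟨h.localDualBasisOfLE he hu, dualTrans_self act he j φ, dualTrans_self act he j ψ⟩)
    (fun p => ⟨h.localDualBasisOfLE he hu, Subtype.ext (act_of_mem_piece (he.idem j) p)⟩)
  refine ⟨C, ⟨fun φ p n z z' hz => ?_, fun φ p => by rw [hε]; rfl⟩, fun i hij n z z' hz φ p =>
    hΔ (hz.localDualBasisOfLE he hij) _ p (LinearMap.ext fun p =>
      congrArg φ (proj_coe act he (proj act (e i) p)))⟩
  have := hΔ (hz.localDualBasisOfLE he hu) φ p (dualTrans_self act he j φ)
  simp only [IsDualBasis.localDualBasisOfLE, dualTrans_self act he] at this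
  exact this

theorem exists_comatrixCoring (he : IsIdempotentLocalUnits e) (hfirm : (bimoduleOf act).IsFirm)
    (h : ∀ i, ∃ (n : ℕ) (z : Fin n → piece act (e i)) (z' : Fin n → PieceDual act (e i)),
      IsDualBasis z z') :
    ∃ C : Coring (comatrix act he), IsComatrixCoring act he C := by
  obtain ⟨C, hε, hΔ⟩ := exists_coring_of_localDualBasis (Q := daggerBimodule act he)
    (N := bimoduleOf act) (comatrixEval act he) (fun φ => one_smul A φ)
    (fun p => one_smul Aᵐᵒᵖ p)
    (fun φ ψ => by
      obtain ⟨i, hφ, hψ⟩ := exists_dualMap_daggerRes₂ act he φ ψ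
      obtain ⟨n, z, z', hz⟩ := h i
      exact ⟨hz.localDualBasis he, hφ, hψ⟩)
    (fun p => by
      obtain ⟨i, hi⟩ := exists_act_eq_self act he hfirm p
      obtain ⟨n, z, z', hz⟩ := h i
      exact ⟨hz.localDualBasis he, hi⟩)
  refine ⟨C, fun i φ p n z z' hz => hΔ (hz.localDualBasis he) _ p
    (dualMap_dualTrans act he (he.idemLE_refl i) φ), fun i φ p => ?_⟩
  rw [hε]
  exact congrArg φ (proj_coe act he p)

theorem IsFinComatrixCoring.unique {c : B} {C D : Coring (finComatrix act c)}
    (hC : IsFinComatrixCoring act c C) (hD : IsFinComatrixCoring act c D)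
    (h : ∃ (n : ℕ) (z : Fin n → piece act c) (z' : Fin n → PieceDual act c),
      IsDualBasis z z') : C = D := by
  obtain ⟨n, z, z', h⟩ := h
  exact Coring.ext_of_hom
    (tensor_ext fun φ p => (hC.comul_eq φ p n z z' h).trans (hD.comul_eq φ p n z z' h).symm)
    (tensor_ext fun φ p => (hC.counit_eq φ p).trans (hD.counit_eq φ p).symm)

/-- Every pure tensor of `P^† ⊗_B P` is in the image of some `P_i^* ⊗_{B_i} P_i`: if
`ψ = ψ e_i`, then `ψ ⊗ p = ψ ⊗ e_i p`. -/
theorem exists_comTmul_eq_comTmul_dualMap (he : IsIdempotentLocalUnits e) (ψ : dagger act he)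
    (p : P) :
    ∃ (i : I) (φ : PieceDual act (e i)) (q : piece act (e i)),
      comTmul act he ψ p = comTmul act he (dualMap act he i φ) q := by
  obtain ⟨i, hi⟩ := exists_dualMap_daggerRes act he ψ
  refine ⟨i, daggerRes act he i ψ, proj act (e i) p, ?_⟩
  have := tmul_balanced (daggerBimodule act he) (bimoduleOf act) (e i) ψ p
  rw [hi]
  exact (congrArg (fun y => comTmul act he y p) hi.symm).trans this

theorem comatrix_ext (he : IsIdempotentLocalUnits e) {X : Type*} [AddCommGroup X] [Module k X]
    {f g : (comatrix act he).carrier →ₗ[k] X}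
    (h : ∀ (i : I) (φ : PieceDual act (e i)) (q : piece act (e i)),
      f (comTmul act he (dualMap act he i φ) q) = g (comTmul act he (dualMap act he i φ) q)) :
    f = g :=
  tensor_ext fun ψ p => by
    obtain ⟨i, φ, q, hq⟩ := exists_comTmul_eq_comTmul_dualMap he ψ p
    have := h i φ q
    rwa [← hq] at this

theorem IsComatrixCoring.unique {he : IsIdempotentLocalUnits e} {C D : Coring (comatrix act he)}
    (hC : IsComatrixCoring act he C) (hD : IsComatrixCoring act he D)
    (h : ∀ i, ∃ (n : ℕ) (z : Fin n → piece act (e i)) (z' : Fin n → PieceDual act (e i)),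
      IsDualBasis z z') : C = D := by
  refine Coring.ext_of_hom (comatrix_ext he fun i φ p => ?_)
    (comatrix_ext he fun i φ p => (hC.counit_eq i φ p).trans (hD.counit_eq i φ p).symm)
  obtain ⟨n, z, z', h⟩ := h i
  rw [hC.comul_eq i φ p n z z' h, hD.comul_eq i φ p n z z' h]

/-! ### The colimit property of the comatrix coring -/

theorem toG_transG (he : IsIdempotentLocalUnits e) {i j : I} (hij : IdemLE e i j)
    (x : (finComatrix act (e i)).carrier) :
    (toG act he j).toLin ((transG act he hij).toLin x) = (toG act he i).toLin x :=
  LinearMap.congr_fun (f := (toG act he j).toLin ∘ₗ (transG act he hij).toLin)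
    (g := (toG act he i).toLin) (tensor_ext fun φ p =>
      congrArg (fun y => comTmul act he y (p : piece act (e i)).1)
      (dualMap_dualTrans act he hij φ)) x

theorem comatrix_isColimit (he : IsIdempotentLocalUnits e) (M : Bimodule.{w₂} k A A)
    (m : ∀ i, Hom (finComatrix act (e i)) M)
    (hm : ∀ i j (hij : IdemLE e i j) x, (m j).toLin ((transG act he hij).toLin x) = (m i).toLin x) :
    ∃! f : Hom (comatrix act he) M, ∀ i x, f.toLin ((toG act he i).toLin x) = (m i).toLin x := by
  let F (i : I) : dagger act he →ₗ[k] P →ₗ[k] M.carrier :=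
    ((tmul (pieceDualBimodule act (e i)) (pieceBimodule act (e i))).compr₂ (m i).toLin).compl₁₂
      ((daggerRes act he i).restrictScalars k) ((proj act (e i)).restrictScalars k)
  have hF : ∀ i ψ p, F i ψ p =
    (m i).toLin (finTmul act (e i) (daggerRes act he i ψ) (proj act (e i) p)) := fun _ _ _ => rfl
  -- For `ψ = ψ ∘ e_i` the map `F i ψ` on all of `P` is unchanged when `i` grows, because
  -- `ψ|P_j ⊗ e_j p = (ψ|P_j) e_i ⊗ e_j p = ψ|P_j ⊗ e_i p` over `B_j`.
  have hle : ∀ i j, IdemLE e i j → ∀ ψ, dualMap act he i (daggerRes act he i ψ) = ψ →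
      F j ψ = F i ψ := by
    intro i j hij ψ hi
    ext p
    have h := tmul_balanced (pieceDualBimodule act (e j)) (pieceBimodule act (e j))
      ⟨e i, hij.mem_cornerAlg⟩ (daggerRes act he j ψ) (proj act (e j) p)
    have h₁ : (pieceDualBimodule act (e j)).right (op ⟨e i, hij.mem_cornerAlg⟩)
        (daggerRes act he j ψ) = daggerRes act he j ψ :=
      congrArg (daggerRes act he j) hi
    have h₂ : (pieceBimodule act (e j)).left ⟨e i, hij.mem_cornerAlg⟩ (proj act (e j) p) =
        incl act hij (proj act (e i) p) :=
      Subtype.ext ((act_act act (e i) (e j) p).trans (by rw [hij.1]; rfl))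
    rw [h₁, h₂, daggerRes_of_le act he j hi] at h
    rw [hF, hF, ← hm i j hij, daggerRes_of_le act he j hi]
    exact congrArg (m j).toLin h
  obtain ⟨f, hf⟩ := exists_linearMap_eq_of_agree (R := k) (V := dagger act he)
    (X := P →ₗ[k] M.carrier) (fun i => (daggerAt act he i).restrictScalars k) F
    (exists_dualMap_daggerRes₂ act he)
    (fun i j ψ hi hj => by
      obtain ⟨l, hil, hjl, -⟩ := he.exists_idemLE i j (e i)
      rw [← hle i l hil ψ hi, ← hle j l hjl ψ hj])
  replace hf : ∀ i ψ, dualMap act he i (daggerRes act he i ψ) = ψ → f ψ = F i ψ := hf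
  have hbal : ∀ b ψ p, f ((daggerBimodule act he).right (op b) ψ) p =
      f ψ ((bimoduleOf act).left b p) := by
    intro b ψ p
    obtain ⟨j, hj⟩ := exists_dualMap_daggerRes act he ψ
    -- Enlarging the index puts `b` into the corner `B_i`, where the tensor product is balanced.
    obtain ⟨i, hji, -, hb, hb'⟩ := he.exists_idemLE j j b
    have hi := dualMap_daggerRes_of_le act he hji hj
    have hmem : b ∈ cornerAlg k (e i) := ⟨b, by rw [hb, hb']⟩
    have hi' : dualMap act he i (daggerRes act he i ((daggerBimodule act he).right (op b) ψ)) =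
        (daggerBimodule act he).right (op b) ψ :=
      Subtype.ext (LinearMap.ext fun p => congrArg ψ.1 ((act_act act b (e i) p).trans
        (by rw [hb']; rfl)))
    have h := tmul_balanced (pieceDualBimodule act (e i)) (pieceBimodule act (e i))
      ⟨b, hmem⟩ (daggerRes act he i ψ) (proj act (e i) p)
    have h₂ : (pieceBimodule act (e i)).left ⟨b, hmem⟩ (proj act (e i) p) =
        proj act (e i) (act b p) :=
      Subtype.ext ((act_act act b (e i) p).trans
        ((act_act act (e i) b p).trans (by rw [hb, hb'])).symm)
    rw [h₂] at h
    rw [hf i _ hi', hf i ψ hi, hF, hF]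
    exact congrArg (m i).toLin h
  have hl : ∀ a ψ p, f ((daggerBimodule act he).left a ψ) p = M.left a (f ψ p) := by
    intro a ψ p
    obtain ⟨i, hi, hi'⟩ := exists_dualMap_daggerRes₂ act he ψ ((daggerBimodule act he).left a ψ)
    rw [hf i _ hi', hf i ψ hi, hF, hF, ← (m i).map_left]
    rfl
  have hr : ∀ a ψ p, f ψ ((bimoduleOf act).right a p) = M.right a (f ψ p) := by
    intro a ψ p
    obtain ⟨i, hi⟩ := exists_dualMap_daggerRes act he ψ
    rw [hf i ψ hi, hF, hF, ← (m i).map_right]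
    exact congrArg (fun y => (m i).toLin (finTmul act (e i) (daggerRes act he i ψ) y))
      ((proj act (e i)).map_smul a p)
  have hgen : ∀ i (φ : PieceDual act (e i)) (p : piece act (e i)),
      f (dualMap act he i φ) p = (m i).toLin (finTmul act (e i) φ p) := by
    intro i φ p
    rw [hf i _ (congrArg (dualMap act he i) (daggerRes_dualMap act he i φ)), hF,
      daggerRes_dualMap, proj_coe act he]
  obtain ⟨g, hg⟩ : ∃ g : Hom (comatrix act he) M, ∀ ψ p, g.toLin (comTmul act he ψ p) = f ψ p :=
    ⟨liftHom (M := daggerBimodule act he) (N := bimoduleOf act) f hbal hl hr, fun _ _ => rfl⟩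
  refine ⟨g, fun i => LinearMap.congr_fun (f := g.toLin ∘ₗ (toG act he i).toLin)
    (tensor_ext fun φ p => (hg _ _).trans (hgen i φ p)), fun g' hg' =>
    Hom.ext (comatrix_ext he fun i φ p => ?_)⟩
  rw [hg, hgen]
  exact hg' i (finTmul act (e i) φ p)

theorem isCoringHom_toG (he : IsIdempotentLocalUnits e) (i : I) {C : Coring (finComatrix act (e i))}
    {D : Coring (comatrix act he)} (hC : IsFinComatrixCoring act (e i) C)
    (hD : IsComatrixCoring act he D)
    (h : ∃ (n : ℕ) (z : Fin n → piece act (e i)) (z' : Fin n → PieceDual act (e i)),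
      IsDualBasis z z') : IsCoringHom C D (toG act he i) := by
  obtain ⟨n, z, z', hz⟩ := h
  constructor
  · refine LinearMap.congr_fun (f := map (toG act he i) (toG act he i) ∘ₗ C.comul.toLin)
      (g := D.comul.toLin ∘ₗ (toG act he i).toLin) (tensor_ext fun φ p => ?_)
    refine (congrArg (map (toG act he i) (toG act he i)) (hC.comul_eq φ p n z z' hz)).trans
      (Eq.trans ?_ (hD.comul_eq i φ p n z z' hz).symm)
    rw [map_sum]
    rfl
  · exact LinearMap.congr_fun (f := D.counit.toLin ∘ₗ (toG act he i).toLin)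
      (tensor_ext fun φ p => (hD.counit_eq i φ p).trans (hC.counit_eq φ p).symm)

theorem isCoringHom_transG (he : IsIdempotentLocalUnits e) {i j : I} (hij : IdemLE e i j)
    {C : Coring (finComatrix act (e i))} {D : Coring (finComatrix act (e j))}
    (hC : IsFinComatrixCoring act (e i) C) (hD : IsFinComatrixCoring act (e j) D)
    (h : ∀ i, ∃ (n : ℕ) (z : Fin n → piece act (e i)) (z' : Fin n → PieceDual act (e i)),
      IsDualBasis z z') : IsCoringHom C D (transG act he hij) := by
  obtain ⟨n, z, z', hz⟩ := h i
  obtain ⟨_, _, _, hw⟩ := h j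
  obtain ⟨D', hD', hΔ⟩ := exists_finComatrixCoring he j hw
  obtain rfl := hD'.unique hD (h j)
  constructor
  · refine LinearMap.congr_fun (f := map (transG act he hij) (transG act he hij) ∘ₗ C.comul.toLin)
      (g := D'.comul.toLin ∘ₗ (transG act he hij).toLin) (tensor_ext fun φ p => ?_)
    refine (congrArg (map (transG act he hij) (transG act he hij))
      (hC.comul_eq φ p n z z' hz)).trans
      (Eq.trans ?_ (hΔ i hij n z z' hz φ (incl act hij p)).symm)
    rw [map_sum]
    rfl
  · refine LinearMap.congr_fun (f := D'.counit.toLin ∘ₗ (transG act he hij).toLin)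
      (tensor_ext fun φ p => Eq.trans ?_ (hC.counit_eq φ p).symm)
    exact (hD.counit_eq _ _).trans (congrArg φ (proj_coe act he p))

/-- A bimodule map out of `P^† ⊗_B P` is a coring morphism if its composites with all `g_i` are. -/
theorem isCoringHom_of_toG (he : IsIdempotentLocalUnits e)
    {Cf : ∀ i, Coring (finComatrix act (e i))} {C : Coring (comatrix act he)}
    (hg : ∀ i, IsCoringHom (Cf i) C (toG act he i)) {M : Bimodule.{w₂} k A A} {D : Coring M}
    {m : ∀ i, Hom (finComatrix act (e i)) M} (hm : ∀ i, IsCoringHom (Cf i) D (m i))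
    {f : Hom (comatrix act he) M}
    (hf : ∀ i x, f.toLin ((toG act he i).toLin x) = (m i).toLin x) : IsCoringHom C D f := by
  constructor
  · refine LinearMap.congr_fun (f := map f f ∘ₗ C.comul.toLin) (g := D.comul.toLin ∘ₗ f.toLin)
      (comatrix_ext he fun i φ p => ?_)
    change map f f (C.comul.toLin ((toG act he i).toLin (finTmul act (e i) φ p))) =
      D.comul.toLin (f.toLin ((toG act he i).toLin (finTmul act (e i) φ p)))
    rw [← (hg i).1, map_map (hf i), hf, (hm i).1]
  · refine LinearMap.congr_fun (f := D.counit.toLin ∘ₗ f.toLin) (comatrix_ext he fun i φ p => ?_)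
    change D.counit.toLin (f.toLin ((toG act he i).toLin (finTmul act (e i) φ p))) =
      C.counit.toLin ((toG act he i).toLin (finTmul act (e i) φ p))
    rw [(hg i).2, hf, (hm i).2]

end System

theorem corollary4p10 {k A B P I : Type*} [CommRing k] [Ring A] [Algebra k A]
    [NonUnitalRing B] [Module k B] [IsScalarTower k B B] [SMulCommClass k B B]
    [AddCommGroup P] [Module k P] [Module Aᵐᵒᵖ P] [IsScalarTower k Aᵐᵒᵖ P]
    -- `B` has idempotent local units, `P` is a firm `(B, A)`-bimodule, and each `P_i = e_i P` is
    -- finitely generated projective over `A`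
    (e : I → B) (he : IsIdempotentLocalUnits e)
    (act : B →ₙₐ[k] Module.End Aᵐᵒᵖ P) (hfirm : (bimoduleOf act).IsFirm)
    (hfin : ∀ i, Module.Finite Aᵐᵒᵖ (piece act (e i)))
    (hproj : ∀ i, Module.Projective Aᵐᵒᵖ (piece act (e i))) :
    -- `P^†`, with the maps `φ ↦ φ ∘ τ_i`, is the colimit of the left `A`-modules `P_i^*`
    ((∀ i j, IdemLE e i j → ∀ φ, dualMap act he j (dualTrans act e i j φ) = dualMap act he i φ) ∧
      ∀ (M : Type w₁) [AddCommGroup M] [Module A M] (m : ∀ i, PieceDual act (e i) →ₗ[A] M),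
        (∀ i j, IdemLE e i j → ∀ φ, m j (dualTrans act e i j φ) = m i φ) →
        ∃! f : dagger act he →ₗ[A] M, ∀ i φ, f (dualMap act he i φ) = m i φ) ∧
    -- finite dual bases exist, so that the following formulas make sense
    (∀ i, ∃ (n : ℕ) (z : Fin n → piece act (e i)) (z' : Fin n → PieceDual act (e i)),
      IsDualBasis z z') ∧
    -- the coring structures on `P_i^* ⊗_{B_i} P_i` and on `P^† ⊗_B P`
    (∀ i, ∃! C : Coring (finComatrix act (e i)), IsFinComatrixCoring act (e i) C) ∧
    (∃! C : Coring (comatrix act he), IsComatrixCoring act he C) ∧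
    -- the latter is the colimit of the former, both as an `A`-bimodule and as an `A`-coring
    (∀ (Cf : ∀ i, Coring (finComatrix act (e i))) (C : Coring (comatrix act he)),
      (∀ i, IsFinComatrixCoring act (e i) (Cf i)) → IsComatrixCoring act he C →
      (∀ i j (hij : IdemLE e i j), IsCoringHom (Cf i) (Cf j) (transG act he hij)) ∧
      (∀ i, IsCoringHom (Cf i) C (toG act he i)) ∧
      (∀ i j (hij : IdemLE e i j) x,
        (toG act he j).toLin ((transG act he hij).toLin x) = (toG act he i).toLin x) ∧
      ∀ (M : Bimodule.{w₂} k A A) (m : ∀ i, Bimodule.Hom (finComatrix act (e i)) M),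
        (∀ i j (hij : IdemLE e i j) x,
          (m j).toLin ((transG act he hij).toLin x) = (m i).toLin x) →
        (∃! f : Bimodule.Hom (comatrix act he) M,
          ∀ i x, f.toLin ((toG act he i).toLin x) = (m i).toLin x) ∧
        ∀ D : Coring M, (∀ i, IsCoringHom (Cf i) D (m i)) →
          ∃! f : Bimodule.Hom (comatrix act he) M, IsCoringHom C D f ∧
            ∀ i x, f.toLin ((toG act he i).toLin x) = (m i).toLin x) := by
  have hdual := fun i => @exists_isDualBasis A _ (piece act (e i)) _ _ (hfin i) (hproj i)
  refine ⟨⟨fun i j hij φ => dualMap_dualTrans act he hij φ,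
    fun M _ _ m hm => dagger_isColimit act he M m hm⟩, hdual,
    fun i => ?_, existsUnique_of_exists_of_unique (exists_comatrixCoring he hfirm hdual)
      fun C D hC hD => hC.unique hD hdual, fun Cf C hCf hC => ?_⟩
  · obtain ⟨n, z, z', hz⟩ := hdual i
    obtain ⟨C, hC, -⟩ := exists_finComatrixCoring he i hz
    exact ⟨C, hC, fun D hD => hD.unique hC (hdual i)⟩
  have hg := fun i => isCoringHom_toG he i (hCf i) hC (hdual i)
  refine ⟨fun i j hij => isCoringHom_transG he hij (hCf i) (hCf j) hdual, hg,
    fun i j hij x => toG_transG he hij x, fun M m hm => ?_⟩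
  have hcolim := comatrix_isColimit he M m hm
  refine ⟨hcolim, fun D hD => ?_⟩
  obtain ⟨f, hf, huniq⟩ := hcolim
  exact ⟨f, ⟨isCoringHom_of_toG he hg hD hf, hf⟩, fun g hg' => huniq g hg'.2⟩
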